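/- Let $A,B\in\mathbb{C}^{n\times n}$ ($n\ge 1$) with $A$ Hermitian, let $\tau>0$, and put $$T(z)=zI-A-Be^{-\tau z},\qquad R(z)=(zI-A)^{-1}\qquad(z\in\mathbb{C}).$$ Let $\alpha(A)$ be the largest real part of an eigenvalue of $A$, and let $\alpha(T)$ be the largest real part of an eigenvalue of $T$, that is, of a point $z$ at which $T(z)$ is singular. Assume $\alpha(A)<0$ and $\alpha(T)<0$. Let $y_0>0$ and let $\eta$ be such that $$1<\eta y_0<\min\Big\{\frac{y_0}{\|B\|_2},\;e^{-\alpha(T)\tau},\;e^{-\alpha(A)\tau}\Big\},$$ where $y_0/\|B\|_2$ is read as $+\infty$ if $B=0$, and set $x_0=-\frac1\tau\log(\eta y_0)$. Let $\Psi$ be the fundamental solution of the delay differential equation $\dot u(t)=Au(t)+Bu(t-\tau)$, that is, the matrix-valued function on $[-\tau,\infty)$ with $\Psi=0$ on $[-\tau,0)$ and $\Psi(0)=I$ which is continuous on $[0,\infty)$ and satisfies $\dot\Psi(t)=A\Psi(t)+B\Psi(t-\tau)$ for $t\ge0$, with $\dot\Psi$ the right-hand derivative. Then for every $t\ge\tau$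 $$\|\Psi(t)\|_2\le\|e^{At}\|_2+e^{x_0t}I_0+e^{x_0t}\frac{C}{t/\tau},$$ where $$I_0=\frac1{2\pi}\int_{-y_0}^{y_0}\big\|T(x_0+iy)^{-1}-R(x_0+iy)\big\|_2\,dy,\qquad C=\frac{\|B\|_2\,\eta\,\sqrt{(\tau y_0)^{-2}+1}}{\pi\,(1-\|B\|_2\,\eta)}.$$ -/

import Mathlib

open scoped Matrix.Norms.L2Operator

noncomputable section

namespace DelayDE

/-- The characteristic matrix function `T(z) = z I - A - B e^{-τ z}` of the delay equation
`u'(t) = A u(t) + B u(t - τ)`. -/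
def charMatrix {n : ℕ} (A B : Matrix (Fin n) (Fin n) ℂ) (τ : ℝ) (z : ℂ) :
    Matrix (Fin n) (Fin n) ℂ :=
  z • (1 : Matrix (Fin n) (Fin n) ℂ) - A - Complex.exp (-(τ : ℂ) * z) • B

/-- The resolvent `R(z) = (z I - A)⁻¹`. -/
def resolventMatrix {n : ℕ} (A : Matrix (Fin n) (Fin n) ℂ) (z : ℂ) :
    Matrix (Fin n) (Fin n) ℂ :=
  (z • (1 : Matrix (Fin n) (Fin n) ℂ) - A)⁻¹

/-- The spectral abscissa `α(A)`: the largest real part of an eigenvalue of the matrix `A`. -/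
def spectralAbscissa {n : ℕ} (A : Matrix (Fin n) (Fin n) ℂ) : ℝ :=
  sSup (Complex.re '' spectrum ℂ A)

/-- The eigenvalues of a matrix-valued function `T`: the points where `T` is singular. -/
def eigenvalueSet {n : ℕ} (T : ℂ → Matrix (Fin n) (Fin n) ℂ) : Set ℂ :=
  {z | ¬ IsUnit (T z)}

/-- The abscissa `α(T)` of a matrix-valued function `T`: the largest real part of an eigenvalue
of `T`. -/
def functionAbscissa {n : ℕ} (T : ℂ → Matrix (Fin n) (Fin n) ℂ) : ℝ :=
  sSup (Complex.re '' eigenvalueSet T)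

/-- The contour function `x(y) = -(1/τ) log (|y| η)`. -/
def contourRe (τ η y : ℝ) : ℝ := -(1 / τ) * Real.log (|y| * η)

/-- `Ψ` is the fundamental solution of `u'(t) = A u(t) + B u(t - τ)`: it vanishes on `[-τ, 0)`,
equals the identity at `0`, is continuous on `[0, ∞)` and satisfies the equation there.
The derivative is the one from the right, because `Ψ` jumps at `0`, so that it has no two-sided
derivative at `0`, nor in general at `τ`; at all other `t > 0` the right-hand side is continuous
and the derivative is two-sided. -/
structure IsFundamentalSolution {n : ℕ} (A B : Matrix (Fin n) (Fin n) ℂ) (τ : ℝ)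
    (Ψ : ℝ → Matrix (Fin n) (Fin n) ℂ) : Prop where
  eq_zero : ∀ t ∈ Set.Ico (-τ) 0, Ψ t = 0
  eq_one : Ψ 0 = 1
  continuousOn : ContinuousOn Ψ (Set.Ici 0)
  hasDeriv : ∀ t : ℝ, 0 ≤ t →
    HasDerivWithinAt Ψ (A * Ψ t + B * Ψ (t - τ)) (Set.Ici t) t

/-- The quantity `I₀ = (1/2π) ∫_{-y₀}^{y₀} ‖T(x₀ + i y)⁻¹ - R(x₀ + i y)‖₂ dy`
with `x₀ = x(y₀)`. -/
def contourIntegral {n : ℕ} (A B : Matrix (Fin n) (Fin n) ℂ) (τ η y₀ : ℝ) : ℝ :=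
  1 / (2 * Real.pi) * ∫ y in (-y₀)..y₀,
    ‖(charMatrix A B τ ((contourRe τ η y₀ : ℂ) + (y : ℂ) * Complex.I))⁻¹
      - resolventMatrix A ((contourRe τ η y₀ : ℂ) + (y : ℂ) * Complex.I)‖

/-- The constant `C = ‖B‖₂ η √((τ y₀)⁻² + 1) / (π (1 - ‖B‖₂ η))`. -/
def tailConstant {n : ℕ} (B : Matrix (Fin n) (Fin n) ℂ) (τ η y₀ : ℝ) : ℝ :=
  ‖B‖ * η * Real.sqrt (((τ * y₀) ^ 2)⁻¹ + 1) / (Real.pi * (1 - ‖B‖ * η))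

/-- The real parts of the eigenvalues of the characteristic function are bounded above, so that
the supremum in its abscissa is a genuine one. -/
theorem bddAbove_re_eigenvalueSet {n : ℕ} (A B : Matrix (Fin n) (Fin n) ℂ) {τ : ℝ}
    (hτ : 0 < τ) : BddAbove (Complex.re '' eigenvalueSet (charMatrix A B τ)) := by
  refine ⟨‖A‖ + ‖B‖, ?_⟩
  rintro _ ⟨z, hz, rfl⟩
  by_contra! hlt
  apply hz
  have h0 : 0 < z.re := lt_of_le_of_lt (by positivity) hlt
  have hz0 : z ≠ 0 := fun h => by simp [h] at h0
  have he : ‖Complex.exp (-(τ : ℂ) * z)‖ ≤ 1 := by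
    rw [Complex.norm_exp]
    simp
    positivity
  have hn : ‖z⁻¹ • (A + Complex.exp (-(τ : ℂ) * z) • B)‖ < 1 := by
    rw [norm_smul, norm_inv, inv_mul_lt_iff₀ (norm_pos_iff.2 hz0), mul_one]
    calc ‖A + Complex.exp (-(τ : ℂ) * z) • B‖
        ≤ ‖A‖ + ‖Complex.exp (-(τ : ℂ) * z)‖ * ‖B‖ := by
          rw [← norm_smul]; exact norm_add_le _ _
      _ ≤ ‖A‖ + 1 * ‖B‖ := by gcongr
      _ < z.re := by simpa using hlt
      _ ≤ ‖z‖ := Complex.re_le_norm z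
  have hu := (isUnit_one_sub_of_norm_lt_one hn).smul (Units.mk0 z hz0)
  have heq : (Units.mk0 z hz0) • (1 - z⁻¹ • (A + Complex.exp (-(τ : ℂ) * z) • B))
      = charMatrix A B τ z := by
    rw [Units.smul_mk0, smul_sub, smul_smul, mul_inv_cancel₀ hz0, one_smul, charMatrix]
    abel
  rwa [heq] at hu

/-- The terms of the method of steps: `P₀(s) = e^{sA}` and
`P_{k+1}(s) = e^{sA} ∫_0^s e^{-rA} B P_k(r) dr`. -/
def stepTerm {n : ℕ} (A B : Matrix (Fin n) (Fin n) ℂ) : ℕ → ℝ → Matrix (Fin n) (Fin n) ℂ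
  | 0 => fun s => NormedSpace.exp (s • A)
  | k + 1 => fun s => NormedSpace.exp (s • A) *
      ∫ r in (0 : ℝ)..s, NormedSpace.exp (r • (-A)) * (B * stepTerm A B k r)

theorem hasDerivAt_exp {n : ℕ} (A : Matrix (Fin n) (Fin n) ℂ) (s : ℝ) :
    HasDerivAt (fun s : ℝ => NormedSpace.exp (s • A)) (A * NormedSpace.exp (s • A)) s :=
  hasDerivAt_exp_smul_const' A s

theorem continuous_exp {n : ℕ} (A : Matrix (Fin n) (Fin n) ℂ) :
    Continuous (fun s : ℝ => NormedSpace.exp (s • A)) :=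
  continuous_iff_continuousAt.2 fun s => (hasDerivAt_exp A s).continuousAt

theorem hasDerivAt_stepTerm_succ {n : ℕ} (A B : Matrix (Fin n) (Fin n) ℂ) (k : ℕ)
    (hc : Continuous (stepTerm A B k)) (s : ℝ) :
    HasDerivAt (stepTerm A B (k + 1))
      (A * stepTerm A B (k + 1) s + B * stepTerm A B k s) s := by
  have hcont : Continuous fun r : ℝ =>
      NormedSpace.exp (r • (-A)) * (B * stepTerm A B k r) :=
    (continuous_exp (-A)).mul (continuous_const.mul hc)
  have h1 := (hasDerivAt_exp A s).mul (hcont.integral_hasStrictDerivAt 0 s).hasDerivAt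
  have hinv : NormedSpace.exp (s • A) * NormedSpace.exp (s • (-A)) = 1 := by
    rw [← NormedSpace.exp_add_of_commute_of_mem_ball (𝕂 := ℝ)
      ((Commute.refl A).neg_right.smul_left s |>.smul_right s)
      (by simp [NormedSpace.expSeries_radius_eq_top])
      (by simp [NormedSpace.expSeries_radius_eq_top])]
    simp
  have h2 : A * NormedSpace.exp (s • A) *
        (∫ r in (0 : ℝ)..s, NormedSpace.exp (r • (-A)) * (B * stepTerm A B k r))
      + NormedSpace.exp (s • A) * (NormedSpace.exp (s • (-A)) * (B * stepTerm A B k s))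
      = A * stepTerm A B (k + 1) s + B * stepTerm A B k s := by
    rw [← mul_assoc (NormedSpace.exp (s • A)), hinv, one_mul, mul_assoc]
    rfl
  rw [← h2]
  exact h1

theorem continuous_stepTerm {n : ℕ} (A B : Matrix (Fin n) (Fin n) ℂ) (k : ℕ) :
    Continuous (stepTerm A B k) := by
  induction k with
  | zero => exact continuous_exp A
  | succ k ih =>
    exact continuous_iff_continuousAt.2 fun s =>
      (hasDerivAt_stepTerm_succ A B k ih s).continuousAt

/-- `stepTerm` extended by zero to negative times. -/
def stepTermPos {n : ℕ} (A B : Matrix (Fin n) (Fin n) ℂ) (k : ℕ) (s : ℝ) :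
    Matrix (Fin n) (Fin n) ℂ :=
  if s < 0 then 0 else stepTerm A B k s

theorem hasDerivWithinAt_stepTermPos {n : ℕ} (A B : Matrix (Fin n) (Fin n) ℂ) (k : ℕ) (s : ℝ) :
    HasDerivWithinAt (stepTermPos A B k)
      (A * stepTermPos A B k s + B * (if k = 0 then 0 else stepTermPos A B (k - 1) s))
      (Set.Ici s) s := by
  by_cases hs : s < 0
  · have h0 : stepTermPos A B k =ᶠ[nhds s] fun _ => 0 := by
      filter_upwards [gt_mem_nhds hs] with r hr
      simp [stepTermPos, hr]
    have := ((hasDerivAt_const s (0 : Matrix (Fin n) (Fin n) ℂ)).congr_of_eventuallyEq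
      h0).hasDerivWithinAt (s := Set.Ici s)
    simpa [stepTermPos, hs] using this
  · have hd : HasDerivAt (stepTerm A B k)
        (A * stepTerm A B k s + B * (if k = 0 then 0 else stepTerm A B (k - 1) s)) s := by
      cases k with
      | zero => simpa [stepTerm] using hasDerivAt_exp A s
      | succ k => simpa using hasDerivAt_stepTerm_succ A B k (continuous_stepTerm A B k) s
    have h1 : ∀ r ∈ Set.Ici s, stepTermPos A B k r = stepTerm A B k r := fun r hr => by
      have : ¬ r < 0 := not_lt.2 ((not_lt.1 hs).trans hr)
      simp [stepTermPos, this]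
    have := (hd.hasDerivWithinAt (s := Set.Ici s)).congr h1 (h1 s Set.self_mem_Ici)
    simpa [stepTermPos, hs] using this

theorem continuous_stepTermPos_succ {n : ℕ} (A B : Matrix (Fin n) (Fin n) ℂ) (k : ℕ) :
    Continuous (stepTermPos A B (k + 1)) := by
  have h : stepTermPos A B (k + 1) = fun s => stepTerm A B (k + 1) (max s 0) := by
    funext s
    by_cases hs : s < 0
    · simp [stepTermPos, hs, max_eq_right hs.le, stepTerm]
    · simp [stepTermPos, hs, max_eq_left (not_lt.1 hs)]
  rw [h]
  exact (continuous_stepTerm A B (k + 1)).comp (continuous_id.max continuous_const)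

/-- The delay equation has a fundamental solution. -/
theorem exists_isFundamentalSolution {n : ℕ} (A B : Matrix (Fin n) (Fin n) ℂ) {τ : ℝ}
    (hτ : 0 < τ) : ∃ Ψ, IsFundamentalSolution A B τ Ψ := by
  let Ψ : ℝ → Matrix (Fin n) (Fin n) ℂ := fun t =>
    ∑ k ∈ Finset.range (⌊t / τ⌋₊ + 1), stepTermPos A B k (t - k * τ)
  have hΨ : ∀ (N : ℕ) (t : ℝ), t < N * τ → 0 < N →
      Ψ t = ∑ k ∈ Finset.range N, stepTermPos A B k (t - k * τ) := by
    intro N t ht hN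
    apply Finset.sum_subset
    · intro k hk
      simp only [Finset.mem_range] at hk ⊢
      rcases lt_or_ge t 0 with h | h
      · have : ⌊t / τ⌋₊ = 0 := Nat.floor_of_nonpos (div_nonpos_of_nonpos_of_nonneg h.le hτ.le)
        omega
      · have : ⌊t / τ⌋₊ < N := (Nat.floor_lt (by positivity)).2 ((div_lt_iff₀ hτ).2 ht)
        omega
    · intro k _ hk
      simp only [Finset.mem_range, not_lt] at hk
      have h1 : t / τ < k := lt_of_lt_of_le (Nat.lt_floor_add_one _) (by exact_mod_cast hk)
      have h2 : t - k * τ < 0 := by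
        rw [div_lt_iff₀ hτ] at h1; linarith
      simp [stepTermPos, h2]
  have hex : ∀ t : ℝ, ∃ N : ℕ, 0 < N ∧ t < N * τ := fun t => by
    obtain ⟨N, hN⟩ := exists_nat_gt (t / τ)
    refine ⟨N + 1, by omega, ?_⟩
    rw [div_lt_iff₀ hτ] at hN
    push_cast
    linarith
  refine ⟨Ψ, ?_, ?_, ?_, ?_⟩
  · intro t ht
    rw [hΨ 1 t (by push_cast; linarith [ht.2]) one_pos]
    simp [stepTermPos, ht.2]
  · rw [hΨ 1 0 (by push_cast; linarith) one_pos]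
    simp [stepTermPos, stepTerm]
  · intro t ht
    obtain ⟨N, hN0, hN⟩ := hex t
    have hev : Ψ =ᶠ[nhdsWithin t (Set.Ici 0)]
        fun t => ∑ k ∈ Finset.range N, stepTermPos A B k (t - k * τ) := by
      filter_upwards [nhdsWithin_le_nhds (gt_mem_nhds hN)] with r hr
      exact hΨ N r hr hN0
    refine ContinuousWithinAt.congr_of_eventuallyEq ?_ hev (hΨ N t hN hN0)
    refine ContinuousOn.continuousWithinAt (s := Set.Ici 0) ?_ ht
    refine continuousOn_finsetSum _ fun k _ => ?_
    cases k with
    | zero =>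
      refine (continuous_stepTerm A B 0).continuousOn.congr fun r hr => ?_
      have : ¬ r < 0 := not_lt.2 hr
      simp [stepTermPos, this]
    | succ k =>
      exact ((continuous_stepTermPos_succ A B k).comp
        (continuous_id.sub continuous_const)).continuousOn
  · intro t _
    obtain ⟨N, hN0, hN⟩ := hex t
    have hN1 : t < ((N + 1 : ℕ) : ℝ) * τ := by push_cast; linarith
    have hev : Ψ =ᶠ[nhdsWithin t (Set.Ici t)]
        fun t => ∑ k ∈ Finset.range (N + 1), stepTermPos A B k (t - k * τ) := by
      filter_upwards [nhdsWithin_le_nhds (gt_mem_nhds hN1)] with r hr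
      exact hΨ (N + 1) r hr N.succ_pos
    refine HasDerivWithinAt.congr_of_eventuallyEq ?_ hev (hΨ (N + 1) t hN1 N.succ_pos)
    have hsum : A * Ψ t + B * Ψ (t - τ) = ∑ k ∈ Finset.range (N + 1),
        (A * stepTermPos A B k (t - k * τ) +
          B * (if k = 0 then 0 else stepTermPos A B (k - 1) (t - k * τ))) := by
      rw [Finset.sum_add_distrib, ← Finset.mul_sum, ← Finset.mul_sum,
        ← hΨ (N + 1) t hN1 N.succ_pos, hΨ N (t - τ) (by linarith) hN0, Finset.sum_range_succ']
      congr 2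
      simp only [Nat.add_eq_zero_iff, one_ne_zero, and_false, if_false, if_true, add_zero,
        Nat.add_sub_cancel]
      refine Finset.sum_congr rfl fun k _ => ?_
      congr 1
      push_cast
      ring
    rw [hsum]
    refine HasDerivWithinAt.fun_sum fun k _ => ?_
    have h := HasDerivWithinAt.scomp (h := fun r => r - k * τ) (s := Set.Ici t) t
      (hasDerivWithinAt_stepTermPos A B k (t - k * τ))
      ((hasDerivWithinAt_id t _).sub_const (k * τ)) (fun r hr => by simpa using hr)
    simpa [Function.comp_def] using h

end DelayDE

end

/-! For `Re z` large, `T(z)⁻¹` is the Laplace transform of `Ψ` and `R(z)` that of `e^{tA}`. Hence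
`Ψ(t) - e^{tA}` is `1/(2π)` times the integral of `e^{zt} (T(z)⁻¹ - R(z))` over a vertical line `Re
z = c`. Subtracting `R` removes the jump at `0` and leaves a transform of size `|Im z|⁻²`, so the
integral converges absolutely.

The line is then pushed left onto the segment `Re z = x₀`, `|Im z| ≤ y₀`, continued by the curves
`Re z = x(y) = -(1/τ) log(|y| η)`, `|y| ≥ y₀`. On and to the right of the curves `|e^{-τz}| ≤ η
|y|`, while `‖R(z)‖ ≤ 1/|y|` because `A` is Hermitian. So `E = e^{-τz} B R(z)` has norm at most `‖B‖
η < 1`, and `T(z) = (1 - E)(zI - A)` is invertible by a Neumann series (`charMatrix_eq`,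
`norm_inv_charMatrix_sub_resolventMatrix_le`). Near the real axis no singularity is crossed, since
the upper bounds on `η y₀` say that `x₀` exceeds both abscissas.

The segment yields `e^{x₀t} I₀`. On the curves the integrand is `O(e^{x(y)t}/|y|)`, which has an
explicit primitive because `x'(y) = -1/(τy)`; this is the source of `C/(t/τ)`. -/

noncomputable section

namespace DelayDE

open Set MeasureTheory Filter Topology Complex

/-! ### Cauchy's theorem beside a convex graph -/

section Contour

variable {E : Type*} [NormedAddCommGroup E] [NormedSpace ℂ E] [CompleteSpace E]

theorem integral_deriv_smul_comp_eq_sub {F H : ℂ → E} {K : Set ℂ}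
    (hH : ∀ z ∈ K, HasDerivWithinAt H (F z) K z) (hF : ContinuousOn F K)
    {γ γ' : ℝ → ℂ} {a b : ℝ} (hab : a ≤ b) (hγ : ∀ y ∈ Icc a b, HasDerivAt γ (γ' y) y)
    (hγ' : ContinuousOn γ' (Icc a b)) (hK : MapsTo γ (Icc a b) K) :
    ∫ y in a..b, γ' y • F (γ y) = H (γ b) - H (γ a) := by
  have hγc : ContinuousOn γ (Icc a b) := fun y hy => (hγ y hy).continuousAt.continuousWithinAt
  have hd : ∀ y ∈ Icc a b, HasDerivWithinAt (H ∘ γ) (γ' y • F (γ y)) (Icc a b) y := fun y hy =>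
    (hH (γ y) (hK hy)).scomp y (hγ y hy).hasDerivWithinAt hK
  have := intervalIntegral.integral_eq_sub_of_hasDeriv_right_of_le (f := H ∘ γ)
    (f' := fun y => γ' y • F (γ y)) hab (fun y hy => (hd y hy).continuousWithinAt)
    (fun y hy => ((hd y (Ioo_subset_Icc_self hy)).hasDerivAt
      (Icc_mem_nhds hy.1 hy.2)).hasDerivWithinAt)
    (ContinuousOn.intervalIntegrable_of_Icc hab (hγ'.smul (hF.comp hγc hK)))
  exact this

/-- Cauchy's theorem on the region between the vertical line `Re z = c` and the graph
`Re z = g (Im z)` of a convex function to the left of it. -/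
theorem integral_vertical_eq_integral_graph {F : ℂ → E} {g g' : ℝ → ℝ} {a b c : ℝ} (hab : a ≤ b)
    (hg : ConvexOn ℝ (Icc a b) g) (hg' : ∀ y ∈ Icc a b, HasDerivAt g (g' y) y)
    (hg'c : ContinuousOn g' (Icc a b)) (hc : ∀ y ∈ Icc a b, g y ≤ c)
    (hF : ∀ z : ℂ, z.im ∈ Icc a b → g z.im ≤ z.re → DifferentiableAt ℂ F z) :
    ∫ y in a..b, I • F (c + y * I) = (∫ y in a..b, (g' y + I) • F (g y + y * I))
      + (∫ x in (g b)..c, F (x + b * I)) - ∫ x in (g a)..c, F (x + a * I) := by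
  -- Convexity of `g` makes this region convex, so `F` has a primitive `H` on it, one-sided at the
  -- boundary. Each of the four integrals is then a difference of values of `H` at the corners.
  let K : Set ℂ := {z | z.im ∈ Icc a b ∧ g z.im ≤ z.re}
  have hK : Convex ℝ K := by
    rintro z ⟨hz, hz'⟩ w ⟨hw, hw'⟩ s t hs ht hst
    have him : (s • z + t • w).im = s • z.im + t • w.im := by simp
    have hre : (s • z + t • w).re = s • z.re + t • w.re := by simp
    refine ⟨him ▸ convex_Icc a b hz hw hs ht hst, ?_⟩
    rw [him, hre]
    refine (hg.2 hz hw hs ht hst).trans ?_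
    simp only [smul_eq_mul]
    gcongr
  have hFK : DifferentiableOn ℂ F K := fun z hz => (hF z hz.1 hz.2).differentiableWithinAt
  obtain ⟨H, hH⟩ := hK.exists_forall_hasDerivWithinAt hFK
  have hFc := hFK.continuousOn
  have hline : ∀ y : ℝ, HasDerivAt (fun y : ℝ => (y : ℂ) * I) I y := fun y => by
    simpa using (hasDerivAt_id y).ofReal_comp.mul_const I
  have h1 := integral_deriv_smul_comp_eq_sub hH hFc hab (γ := fun y : ℝ => c + y * I)
    (γ' := fun _ => I) (fun y _ => (hline y).const_add _) continuousOn_const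
    (fun y hy => ⟨by simpa using hy, by simpa using hc y hy⟩)
  have h2 := integral_deriv_smul_comp_eq_sub hH hFc hab (γ := fun y : ℝ => g y + y * I)
    (γ' := fun y => g' y + I) (fun y hy => (hg' y hy).ofReal_comp.add (hline y))
    ((continuous_ofReal.comp_continuousOn hg'c).add continuousOn_const)
    (fun y hy => ⟨by simpa using hy, by simp⟩)
  have h3 : ∀ y ∈ Icc a b, ∫ x in (g y)..c, F (x + y * I) = H (c + y * I) - H (g y + y * I) := by
    intro y hy
    have := integral_deriv_smul_comp_eq_sub hH hFc (hc y hy) (γ := fun x : ℝ => x + y * I)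
      (γ' := fun _ => 1) (fun x _ => (hasDerivAt_id x).ofReal_comp.add_const _) continuousOn_const
      (fun x hx => ⟨by simpa using hy, by simpa using hx.1⟩)
    simpa using this
  rw [h1, h2, h3 b (right_mem_Icc.2 hab), h3 a (left_mem_Icc.2 hab)]
  abel

end Contour

/-! ### Laplace transforms and their inversion -/

section Laplace

variable {E : Type*} [NormedAddCommGroup E] [NormedSpace ℂ E]

theorem integrableOn_exp_neg_smul {D : ℝ → E} {M K : ℝ} (hD : ContinuousOn D (Ici 0))
    (hbd : ∀ t, 0 ≤ t → ‖D t‖ ≤ M * Real.exp (K * t)) {z : ℂ} (hz : K < z.re) :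
    IntegrableOn (fun t : ℝ => exp (-z * t) • D t) (Ioi 0) := by
  have hi : IntegrableOn (fun t : ℝ => M * Real.exp (-(z.re - K) * t)) (Ioi 0) :=
    (exp_neg_integrableOn_Ioi 0 (by linarith)).const_mul M
  refine hi.mono' ?_ ?_
  · refine ContinuousOn.aestronglyMeasurable ?_ measurableSet_Ioi
    exact (by fun_prop : Continuous fun t : ℝ => exp (-z * t)).continuousOn.smul
      (hD.mono Ioi_subset_Ici_self)
  · refine (ae_restrict_iff' measurableSet_Ioi).2 (Eventually.of_forall fun t ht => ?_)
    rw [norm_smul, norm_exp]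
    calc Real.exp (-z * t).re * ‖D t‖
        ≤ Real.exp (-z * t).re * (M * Real.exp (K * t)) := by gcongr; exact hbd t (le_of_lt ht)
      _ = M * Real.exp (-(z.re - K) * t) := by
        rw [mul_left_comm, ← Real.exp_add]
        congr 2
        simp
        ring

/-- Inversion of the Laplace transform of a continuous function of exponential growth whose
transform is integrable on a vertical line. -/
theorem laplace_inversion [CompleteSpace E] {D : ℝ → E} {M K c : ℝ} (hD : Continuous D)
    (h0 : ∀ t < 0, D t = 0) (hbd : ∀ t, 0 ≤ t → ‖D t‖ ≤ M * Real.exp (K * t)) (hc : K < c)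
    {F : ℂ → E}
    (hF : ∀ y : ℝ, F (c + y * I) = ∫ t in Ioi (0 : ℝ), exp (-(c + y * I) * t) • D t)
    (hFi : Integrable fun y : ℝ => F (c + y * I)) (t : ℝ) :
    (2 * Real.pi : ℝ) • D t = ∫ y : ℝ, exp ((c + y * I) * t) • F (c + y * I) := by
  have hpi : (0 : ℝ) < 2 * Real.pi := by positivity
  -- On `Re z = c` the Laplace transform of `D` is the Fourier transform of the damped function `f`,
  -- with `y = 2πw`. Fourier inversion holds at every point because `f` is continuous.
  let f : ℝ → E := fun t => exp (-(c : ℂ) * t) • D t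
  have hfc : Continuous f := (by fun_prop : Continuous fun t : ℝ => exp (-(c : ℂ) * t)).smul hD
  have hf0 : ∀ t ∉ Ici (0 : ℝ), f t = 0 := fun t ht => by
    simp [f, h0 t (not_le.1 ht)]
  have hfi : Integrable f := by
    rw [← integrableOn_iff_integrable_of_support_subset (s := Ici 0)
      (fun t ht => by_contra fun h => ht (hf0 t h)), integrableOn_Ici_iff_integrableOn_Ioi]
    exact integrableOn_exp_neg_smul hD.continuousOn hbd (z := c) (by simpa using hc)
  have hfour : ∀ w : ℝ, FourierTransform.fourier f w = F (c + (2 * Real.pi * w : ℝ) * I) := by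
    intro w
    rw [hF, Real.fourier_eq', ← integral_Ici_eq_integral_Ioi,
      ← setIntegral_eq_integral_of_forall_compl_eq_zero (s := Ici 0)
        (fun t ht => by rw [hf0 t ht, smul_zero])]
    refine setIntegral_congr_fun measurableSet_Ici fun t _ => ?_
    simp only [f, smul_smul, ← exp_add]
    congr 2
    simp
    ring
  have hfi' : Integrable (FourierTransform.fourier f) := by
    have h : FourierTransform.fourier f = fun w : ℝ => F (c + (2 * Real.pi * w : ℝ) * I) :=
      funext hfour
    rw [h]
    exact (integrable_comp_mul_left_iff (fun y : ℝ => F (c + y * I)) hpi.ne').2 hFi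
  have hinv := congrFun (hfc.fourierInv_fourier_eq hfi hfi') t
  rw [Real.fourierInv_eq'] at hinv
  have hch := Measure.integral_comp_mul_left (fun y : ℝ => exp (y * I * t) • F (c + y * I))
    (2 * Real.pi)
  have heq : (∫ w : ℝ, exp (((2 * Real.pi * w : ℝ) : ℂ) * I * t) •
      F (c + (2 * Real.pi * w : ℝ) * I)) = f t := by
    rw [← hinv]
    refine integral_congr_ae (Eventually.of_forall fun w => ?_)
    simp only [hfour]
    congr 2
    simp
    ring
  rw [heq, abs_of_pos (inv_pos.2 hpi)] at hch
  have h3 : D t = exp (c * t) • f t := by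
    simp [f, smul_smul, ← exp_add]
  rw [h3, hch, smul_comm (exp (c * t) : ℂ), smul_smul, mul_inv_cancel₀ hpi.ne', one_smul,
    ← integral_smul]
  refine integral_congr_ae (Eventually.of_forall fun y => ?_)
  simp only [smul_smul, ← exp_add]
  congr 2
  ring

end Laplace

/-! ### Growth and Laplace transform of the fundamental solution -/

section FundamentalSolution

variable {n : ℕ} {A B : Matrix (Fin n) (Fin n) ℂ} {τ : ℝ} {Ψ : ℝ → Matrix (Fin n) (Fin n) ℂ}

/-- Method of steps: on each interval of length `τ` the delayed term is already bounded, and `M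
e^{Kt}` is a strict barrier for the norm. The `+ 1` in `K` gives the strictness; the `+ 1` in `M`
keeps `M` positive even when `n = 0`. -/
theorem IsFundamentalSolution.norm_le (hΨ : IsFundamentalSolution A B τ Ψ) (hτ : 0 < τ) :
    ∀ t, 0 ≤ t → ‖Ψ t‖ ≤
      (‖(1 : Matrix (Fin n) (Fin n) ℂ)‖ + 1) * Real.exp ((‖A‖ + ‖B‖ + 1) * t) := by
  set M := ‖(1 : Matrix (Fin n) (Fin n) ℂ)‖ + 1
  set K := ‖A‖ + ‖B‖ + 1
  have hM : 0 < M := by positivity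
  have hK : 0 < K := by positivity
  have hstep : ∀ N : ℕ, ∀ t, -τ ≤ t → t ≤ N * τ → ‖Ψ t‖ ≤ M * Real.exp (K * t) := by
    intro N
    induction N with
    | zero =>
      intro t h1 h2
      rcases lt_or_eq_of_le (show t ≤ 0 by simpa using h2) with h | rfl
      · rw [hΨ.eq_zero t ⟨h1, h⟩, norm_zero]
        positivity
      · rw [hΨ.eq_one]
        simp [M]
    | succ N ih =>
      intro t h1 h2
      rcases le_total t (N * τ) with h | h
      · exact ih t h1 h
      have hN : 0 ≤ N * τ := by positivity
      have hB : ∀ x, HasDerivAt (fun x => M * Real.exp (K * x)) (M * (K * Real.exp (K * x))) x := by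
        intro x
        refine ((((hasDerivAt_id x).const_mul K).exp).const_mul M).congr_deriv ?_
        simp [mul_comm]
      refine image_norm_le_of_norm_deriv_right_lt_deriv_boundary (a := N * τ) (b := (N + 1) * τ)
        (hΨ.continuousOn.mono fun x hx => hN.trans hx.1)
        (fun x hx => hΨ.hasDeriv x (hN.trans hx.1)) (ih _ (by linarith) le_rfl) hB ?_
        ⟨h, by exact_mod_cast h2⟩
      intro x hx hxe
      have hx' : ‖Ψ (x - τ)‖ ≤ M * Real.exp (K * x) :=
        (ih _ (by linarith [hx.1]) (by linarith [hx.2])).trans (by gcongr; linarith)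
      calc ‖A * Ψ x + B * Ψ (x - τ)‖ ≤ ‖A‖ * ‖Ψ x‖ + ‖B‖ * ‖Ψ (x - τ)‖ :=
            (norm_add_le _ _).trans (add_le_add (norm_mul_le _ _) (norm_mul_le _ _))
        _ ≤ ‖A‖ * (M * Real.exp (K * x)) + ‖B‖ * (M * Real.exp (K * x)) := by
            rw [hxe]; gcongr
        _ < M * (K * Real.exp (K * x)) := by
            have : 0 < M * Real.exp (K * x) := by positivity
            simp only [K] at this ⊢
            linarith
  intro t ht
  obtain ⟨N, hN⟩ := exists_nat_ge (t / τ)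
  exact hstep N t (by linarith) ((div_le_iff₀ hτ).1 hN)

/-- The case `B = 0`, which lets the growth bound and the Laplace transform proved for `Ψ` apply to
`e^{tA}` and `R` as well. -/
theorem isFundamentalSolution_exp (A : Matrix (Fin n) (Fin n) ℂ) (τ : ℝ) :
    IsFundamentalSolution A 0 τ (stepTermPos A 0 0) where
  eq_zero t ht := by simp [stepTermPos, ht.2]
  eq_one := by simp [stepTermPos, stepTerm]
  continuousOn := (continuous_stepTerm A 0 0).continuousOn.congr fun r hr => by
    simp [stepTermPos, not_lt.2 (mem_Ici.1 hr)]
  hasDeriv t _ := by simpa using hasDerivWithinAt_stepTermPos A 0 0 t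

/-- The delayed term has Laplace transform `e^{-τ z}` times that of the solution. -/
theorem IsFundamentalSolution.laplace_delay (hΨ : IsFundamentalSolution A B τ Ψ) (hτ : 0 < τ)
    {z : ℂ} (hi : IntegrableOn (fun t : ℝ => exp (-z * t) • Ψ t) (Ioi 0)) :
    IntegrableOn (fun t : ℝ => exp (-z * t) • Ψ (t - τ)) (Ioi 0) ∧
      ∫ t in Ioi (0 : ℝ), exp (-z * t) • Ψ (t - τ) =
        exp (-τ * z) • ∫ t in Ioi (0 : ℝ), exp (-z * t) • Ψ t := by
  -- Cutting off at `0` turns the delay into a translation of the whole line, under which the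
  -- integral is invariant.
  let g : ℝ → Matrix (Fin n) (Fin n) ℂ := (Ici 0).indicator fun t : ℝ => exp (-z * t) • Ψ t
  have hg : Integrable g :=
    (integrable_indicator_iff measurableSet_Ici).2 (by
      rwa [integrableOn_Ici_iff_integrableOn_Ioi])
  have heq : EqOn (fun t : ℝ => exp (-z * t) • Ψ (t - τ))
      (fun t => exp (-τ * z) • g (t - τ)) (Ioi 0) := by
    intro t ht
    by_cases h : 0 ≤ t - τ
    · simp only [g, indicator_of_mem (mem_Ici.2 h), smul_smul, ← exp_add]
      congr 2
      push_cast
      ring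
    · have h1 : Ψ (t - τ) = 0 := hΨ.eq_zero _ ⟨by linarith [mem_Ioi.1 ht], not_le.1 h⟩
      have h2 : g (t - τ) = 0 := indicator_of_notMem h _
      simp [h1, h2]
  have hgi : Integrable fun t : ℝ => exp (-τ * z) • g (t - τ) :=
    (hg.comp_sub_right τ).smul (exp (-τ * z))
  refine ⟨hgi.integrableOn.congr_fun heq.symm measurableSet_Ioi, ?_⟩
  rw [setIntegral_congr_fun measurableSet_Ioi heq, integral_smul]
  congr 1
  rw [setIntegral_eq_integral_of_forall_compl_eq_zero, integral_sub_right_eq_self g,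
    integral_indicator measurableSet_Ici, integral_Ici_eq_integral_Ioi]
  intro t ht
  exact indicator_of_notMem (by simp at ht ⊢; linarith) _

/-- The Laplace transform of the fundamental solution is the inverse of the characteristic
matrix. -/
theorem IsFundamentalSolution.laplace_eq (hΨ : IsFundamentalSolution A B τ Ψ) (hτ : 0 < τ)
    {z : ℂ} (hz : ‖A‖ + ‖B‖ + 1 < z.re) :
    ∫ t in Ioi (0 : ℝ), exp (-z * t) • Ψ t = (charMatrix A B τ z)⁻¹ := by
  have hbd := hΨ.norm_le hτ
  have hi := integrableOn_exp_neg_smul hΨ.continuousOn hbd hz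
  obtain ⟨hi', hd⟩ := hΨ.laplace_delay hτ hi
  set L := ∫ t in Ioi (0 : ℝ), exp (-z * t) • Ψ t
  -- `h` is the right derivative of `e^{-zt} Ψ(t)`. Its integral over `(0, ∞)` is `0 - I` by the
  -- fundamental theorem and `-T(z) L` term by term, so `T(z) L = I`.
  let h : ℝ → Matrix (Fin n) (Fin n) ℂ := fun t =>
    -(z • (exp (-z * t) • Ψ t)) + (A * (exp (-z * t) • Ψ t) + B * (exp (-z * t) • Ψ (t - τ)))
  have h1 : IntegrableOn (fun t : ℝ => -(z • (exp (-z * t) • Ψ t))) (Ioi 0) := (hi.smul z).neg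
  have h2 : IntegrableOn (fun t : ℝ => A * (exp (-z * t) • Ψ t)) (Ioi 0) := hi.const_mul A
  have h3 : IntegrableOn (fun t : ℝ => B * (exp (-z * t) • Ψ (t - τ))) (Ioi 0) := hi'.const_mul B
  have hh : IntegrableOn h (Ioi 0) := h1.add (h2.add h3)
  have hint : ∫ t in Ioi (0 : ℝ), h t = -(z • L) + (A * L + B * (exp (-τ * z) • L)) := by
    have e1 := integral_add h1 (h2.add h3)
    have e2 := integral_add h2 h3
    simp only [Pi.add_apply] at e1 e2
    simp only [h]
    rw [← hd, e1, e2, integral_neg, integral_smul,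
      integral_const_mul_of_integrable hi, integral_const_mul_of_integrable hi']
  have hftc : ∀ N : ℝ, 0 ≤ N → ∫ t in (0 : ℝ)..N, h t = exp (-z * N) • Ψ N - 1 := by
    intro N hN
    have he : ∀ t : ℝ, HasDerivAt (fun t : ℝ => exp (-z * t)) (exp (-z * t) * (-z)) t := fun t => by
      simpa using ((hasDerivAt_id t).ofReal_comp.const_mul (-z)).cexp
    rw [intervalIntegral.integral_eq_sub_of_hasDeriv_right_of_le
      (f := fun t : ℝ => exp (-z * t) • Ψ t) hN]
    · simp [hΨ.eq_one]
    · exact (by fun_prop : Continuous fun t : ℝ => exp (-z * t)).continuousOn.smul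
        (hΨ.continuousOn.mono Icc_subset_Ici_self)
    · intro t ht
      refine HasDerivWithinAt.congr_deriv
        ((he t).hasDerivWithinAt.smul ((hΨ.hasDeriv t ht.1.le).mono Ioi_subset_Ici_self)) ?_
      simp only [h, Matrix.mul_smul, smul_add, smul_smul]
      rw [add_comm, mul_neg, neg_smul, mul_comm (exp _) z]
    · exact (intervalIntegrable_iff_integrableOn_Ioc_of_le hN).2 (hh.mono_set Ioc_subset_Ioi_self)
  have hlim : Tendsto (fun N : ℝ => exp (-z * N) • Ψ N) atTop (𝓝 0) := by
    have hc : 0 < z.re - (‖A‖ + ‖B‖ + 1) := by linarith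
    have h0 := ((Real.tendsto_exp_neg_atTop_nhds_zero.comp
      (tendsto_id.const_mul_atTop hc)).const_mul (‖(1 : Matrix (Fin n) (Fin n) ℂ)‖ + 1))
    rw [mul_zero] at h0
    refine squeeze_zero_norm' ?_ h0
    filter_upwards [eventually_ge_atTop 0] with N hN
    rw [norm_smul, norm_exp]
    calc Real.exp (-z * N).re * ‖Ψ N‖
        ≤ Real.exp (-z * N).re * ((‖(1 : Matrix (Fin n) (Fin n) ℂ)‖ + 1) *
            Real.exp ((‖A‖ + ‖B‖ + 1) * N)) := by gcongr; exact hbd N hN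
      _ = _ := by
        rw [mul_left_comm, ← Real.exp_add]
        congr 2
        simp
        ring
  have hlim' := intervalIntegral_tendsto_integral_Ioi 0 hh tendsto_id
  have := tendsto_nhds_unique hlim' ((hlim.sub_const 1).congr' <| by
    filter_upwards [eventually_ge_atTop 0] with N hN using (hftc N hN).symm)
  rw [hint] at this
  symm
  apply Matrix.inv_eq_right_inv
  have h4 : charMatrix A B τ z * L = -(-(z • L) + (A * L + B * (exp (-τ * z) • L))) := by
    simp [charMatrix, sub_mul]
    abel
  rw [h4, this]
  simp

end FundamentalSolution

/-! ### Resolvent bounds and invertibility of the characteristic matrix -/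

section Resolvent

variable {n : ℕ} {A B : Matrix (Fin n) (Fin n) ℂ} {τ : ℝ} {z : ℂ}

theorem isUnit_smul_one_sub_of_im_ne_zero (hA : A.IsHermitian) (hz : z.im ≠ 0) :
    IsUnit (z • (1 : Matrix (Fin n) (Fin n) ℂ) - A) := by
  have hs : IsSelfAdjoint A := hA
  have : z ∉ spectrum ℂ A := fun h => hz (hs.im_eq_zero_of_mem_spectrum h)
  rw [spectrum.notMem_iff, Algebra.algebraMap_eq_smul_one] at this
  exact this

theorem isUnit_smul_one_sub_of_spectralAbscissa_lt (hz : spectralAbscissa A < z.re) :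
    IsUnit (z • (1 : Matrix (Fin n) (Fin n) ℂ) - A) := by
  by_contra h
  have hm : z ∈ spectrum ℂ A := by
    rw [spectrum.mem_iff, Algebra.algebraMap_eq_smul_one]
    exact h
  exact hz.not_ge (le_csSup ((A.finite_spectrum.image _).bddAbove) ⟨z, hm, rfl⟩)

theorem isUnit_charMatrix_of_functionAbscissa_lt (hτ : 0 < τ)
    (hz : functionAbscissa (charMatrix A B τ) < z.re) : IsUnit (charMatrix A B τ z) := by
  by_contra h
  exact hz.not_ge (le_csSup (bddAbove_re_eigenvalueSet A B hτ) ⟨z, h, rfl⟩)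

/-- The resolvent of a Hermitian matrix is bounded by the inverse of the distance to the real
axis. -/
theorem norm_resolventMatrix_le (hA : A.IsHermitian) (hz : z.im ≠ 0) :
    ‖resolventMatrix A z‖ ≤ |z.im|⁻¹ := by
  set R := resolventMatrix A z
  set W := z • (1 : Matrix (Fin n) (Fin n) ℂ) - A
  have hW : IsUnit W.det := (Matrix.isUnit_iff_isUnit_det _).1
    (isUnit_smul_one_sub_of_im_ne_zero hA hz)
  have hRW : R * W = 1 := Matrix.nonsing_inv_mul W hW
  have hWR : W * R = 1 := Matrix.mul_nonsing_inv W hW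
  have hstar : star W * star R = 1 := by rw [← star_mul, hRW, star_one]
  have hWs : star W - W = (star z - z) • (1 : Matrix (Fin n) (Fin n) ℂ) := by
    have : star A = A := hA
    simp only [W, star_sub, star_smul, star_one, this, sub_smul]
    abel
  -- Resolvent identity between `z` and its conjugate. With the C*-identity it gives `2 |Im z| ‖R‖²
  -- ≤ 2 ‖R‖`.
  have h1 : R - star R = (star z - z) • (R * star R) := by
    calc R - star R = R * (star W * star R) - (R * W) * star R := by rw [hstar, hRW]; simp
      _ = R * (star W - W) * star R := by noncomm_ring
      _ = _ := by rw [hWs]; simp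
  have h2 : ‖star z - z‖ = 2 * |z.im| := by
    have : star z - z = ((-2 * z.im : ℝ) : ℂ) * I := by
      apply Complex.ext <;> simp
      ring
    rw [this]
    simp
  have h3 : 2 * |z.im| * (‖R‖ * ‖R‖) ≤ 2 * ‖R‖ := by
    rw [← CStarRing.norm_self_mul_star, ← h2, ← norm_smul, ← h1]
    refine (norm_sub_le _ _).trans ?_
    rw [norm_star]
    linarith
  have hy : 0 < |z.im| := abs_pos.2 hz
  rcases (norm_nonneg R).eq_or_lt with h | h
  · rw [← h]
    positivity
  · rw [le_inv_comm₀ h hy, ← one_div, le_div_iff₀ h]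
    nlinarith

theorem charMatrix_eq (hW : IsUnit (z • (1 : Matrix (Fin n) (Fin n) ℂ) - A)) :
    charMatrix A B τ z = (1 - exp (-τ * z) • (B * resolventMatrix A z)) *
      (z • (1 : Matrix (Fin n) (Fin n) ℂ) - A) := by
  have h : resolventMatrix A z * (z • (1 : Matrix (Fin n) (Fin n) ℂ) - A) = 1 :=
    Matrix.nonsing_inv_mul _ ((Matrix.isUnit_iff_isUnit_det _).1 hW)
  rw [sub_mul, one_mul, smul_mul_assoc, mul_assoc, h, mul_one, charMatrix]

theorem norm_exp_smul_mul_resolventMatrix_le (hA : A.IsHermitian) (hz : z.im ≠ 0) :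
    ‖exp (-τ * z) • (B * resolventMatrix A z)‖ ≤ Real.exp (-τ * z.re) * ‖B‖ * |z.im|⁻¹ := by
  rw [norm_smul, norm_exp, mul_assoc]
  have : (-τ * z : ℂ).re = -τ * z.re := by simp
  rw [this]
  gcongr
  exact (norm_mul_le _ _).trans (by gcongr; exact norm_resolventMatrix_le hA hz)

variable {η : ℝ}

theorem norm_perturbation_le (hA : A.IsHermitian) (hz : z.im ≠ 0)
    (he : Real.exp (-τ * z.re) ≤ η * |z.im|) :
    ‖exp (-τ * z) • (B * resolventMatrix A z)‖ ≤ ‖B‖ * η := by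
  refine (norm_exp_smul_mul_resolventMatrix_le hA hz).trans ?_
  have hy : 0 < |z.im| := abs_pos.2 hz
  calc Real.exp (-τ * z.re) * ‖B‖ * |z.im|⁻¹ ≤ η * |z.im| * ‖B‖ * |z.im|⁻¹ := by gcongr
    _ = ‖B‖ * η := by field_simp

theorem isUnit_charMatrix_of_exp_le (hA : A.IsHermitian) (hz : z.im ≠ 0)
    (he : Real.exp (-τ * z.re) ≤ η * |z.im|) (hB : ‖B‖ * η < 1) :
    IsUnit (charMatrix A B τ z) := by
  have hW := isUnit_smul_one_sub_of_im_ne_zero hA hz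
  rw [charMatrix_eq hW]
  exact (isUnit_one_sub_of_norm_lt_one ((norm_perturbation_le hA hz he).trans_lt hB)).mul hW

/-- With `S = T(z)⁻¹` the factorization gives `S - R = S E`. The bound `‖E‖ ≤ ‖B‖ η` lets `S E` be
absorbed to estimate `‖S‖`; the finer bound on `‖E‖`, with its factor `|Im z|⁻¹`, then supplies the
second power of decay. -/
theorem norm_inv_charMatrix_sub_resolventMatrix_le (hA : A.IsHermitian) (hz : z.im ≠ 0)
    (he : Real.exp (-τ * z.re) ≤ η * |z.im|) (hB : ‖B‖ * η < 1) :
    ‖(charMatrix A B τ z)⁻¹ - resolventMatrix A z‖ ≤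
      Real.exp (-τ * z.re) * ‖B‖ * |z.im|⁻¹ * (|z.im|⁻¹ * (1 - ‖B‖ * η)⁻¹) := by
  have hW := isUnit_smul_one_sub_of_im_ne_zero hA hz
  have hT := isUnit_charMatrix_of_exp_le hA hz he hB
  have hE := norm_perturbation_le (B := B) hA hz he
  have hE' := norm_exp_smul_mul_resolventMatrix_le (B := B) (τ := τ) hA hz
  have hR := norm_resolventMatrix_le hA hz
  have hfac := charMatrix_eq (B := B) (τ := τ) hW
  set E := exp (-τ * z) • (B * resolventMatrix A z)
  set S := (charMatrix A B τ z)⁻¹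
  have hS : S * charMatrix A B τ z = 1 :=
    Matrix.nonsing_inv_mul _ ((Matrix.isUnit_iff_isUnit_det _).1 hT)
  have hWR : (z • (1 : Matrix (Fin n) (Fin n) ℂ) - A) * resolventMatrix A z = 1 :=
    Matrix.mul_nonsing_inv _ ((Matrix.isUnit_iff_isUnit_det _).1 hW)
  have hSR : S - resolventMatrix A z = S * E := by
    have : S * (1 - E) = resolventMatrix A z := by
      calc S * (1 - E) = S * ((1 - E) * ((z • (1 : Matrix (Fin n) (Fin n) ℂ) - A) *
            resolventMatrix A z)) := by rw [hWR, mul_one]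
        _ = (S * charMatrix A B τ z) * resolventMatrix A z := by rw [hfac]; noncomm_ring
        _ = _ := by rw [hS, one_mul]
    rw [← this]
    noncomm_ring
  have hq : 0 < 1 - ‖B‖ * η := by linarith
  have hSn : ‖S‖ ≤ |z.im|⁻¹ * (1 - ‖B‖ * η)⁻¹ := by
    rw [← div_eq_mul_inv, le_div_iff₀ hq]
    have h1 : ‖S‖ ≤ |z.im|⁻¹ + ‖S‖ * (‖B‖ * η) := by
      calc ‖S‖ = ‖resolventMatrix A z + S * E‖ := by rw [← hSR]; congr 1; abel
        _ ≤ ‖resolventMatrix A z‖ + ‖S‖ * ‖E‖ :=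
          (norm_add_le _ _).trans (by gcongr; exact norm_mul_le _ _)
        _ ≤ _ := by gcongr
    linarith
  rw [hSR]
  calc ‖S * E‖ ≤ ‖E‖ * ‖S‖ := (norm_mul_le _ _).trans_eq (mul_comm _ _)
    _ ≤ _ := by gcongr

theorem differentiableAt_matrix_inv {F : ℂ → Matrix (Fin n) (Fin n) ℂ}
    (hF : DifferentiableAt ℂ F z) (hu : IsUnit (F z)) :
    DifferentiableAt ℂ (fun w => (F w)⁻¹) z := by
  simp only [Matrix.nonsing_inv_eq_ringInverse]
  obtain ⟨u, hu⟩ := hu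
  have h := differentiableAt_inverse (𝕜 := ℂ) u.isUnit
  rw [hu] at h
  exact h.comp z hF

theorem differentiableAt_inv_charMatrix_sub_resolventMatrix
    (hT : IsUnit (charMatrix A B τ z)) (hW : IsUnit (z • (1 : Matrix (Fin n) (Fin n) ℂ) - A)) :
    DifferentiableAt ℂ (fun w => (charMatrix A B τ w)⁻¹ - resolventMatrix A w) z := by
  refine (differentiableAt_matrix_inv ?_ hT).sub (differentiableAt_matrix_inv ?_ hW)
  · unfold charMatrix
    fun_prop
  · fun_prop

end Resolvent

/-- The difference `T(z)⁻¹ - R(z)`. -/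
def resolventDiff {n : ℕ} (A B : Matrix (Fin n) (Fin n) ℂ) (τ : ℝ) (z : ℂ) :
    Matrix (Fin n) (Fin n) ℂ :=
  (charMatrix A B τ z)⁻¹ - resolventMatrix A z

/-! ### The curve `x(y) = -(1/τ) log(|y| η)` -/

section ContourFunction

variable {τ η y : ℝ}

theorem contourRe_eq (hη : 0 < η) (hy : y ≠ 0) :
    contourRe τ η y = -(1 / τ) * (Real.log y + Real.log η) := by
  rw [contourRe, Real.log_mul (abs_ne_zero.2 hy) hη.ne', Real.log_abs]

theorem contourRe_neg (τ η y : ℝ) : contourRe τ η (-y) = contourRe τ η y := by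
  simp [contourRe]

theorem hasDerivAt_contourRe (hη : 0 < η) (hy : y ≠ 0) :
    HasDerivAt (contourRe τ η) (-(1 / τ) * y⁻¹) y := by
  have h := ((Real.hasDerivAt_log hy).add_const (Real.log η)).const_mul (-(1 / τ))
  refine h.congr_of_eventuallyEq ?_
  filter_upwards [isOpen_ne.mem_nhds hy] with x hx using contourRe_eq hη hx

theorem convexOn_contourRe {s : Set ℝ} (hτ : 0 < τ) (hη : 0 < η) (hs : Convex ℝ s)
    (h0 : s ⊆ Ioi 0 ∨ s ⊆ Iio 0) : ConvexOn ℝ s (contourRe τ η) := by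
  have hlog : ConcaveOn ℝ s Real.log := by
    rcases h0 with h | h
    · exact strictConcaveOn_log_Ioi.concaveOn.subset h hs
    · exact strictConcaveOn_log_Iio.concaveOn.subset h hs
  have hne : ∀ x ∈ s, x ≠ 0 := fun x hx => by
    rcases h0 with h | h
    · exact (mem_Ioi.1 (h hx)).ne'
    · exact (mem_Iio.1 (h hx)).ne
  refine ((hlog.add_const (Real.log η)).neg.smul (c := 1 / τ) (by positivity)).congr
    fun x hx => ?_
  rw [contourRe_eq hη (hne x hx)]
  simp only [Pi.neg_apply, smul_eq_mul, Pi.add_apply]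
  ring

/-- The curve is chosen so that `e^{-τ x(y)} = η |y|` exactly; to the right of it the exponential
only decreases. -/
theorem exp_neg_mul_le_of_contourRe_le (hτ : 0 < τ) (hη : 0 < η) (hy : y ≠ 0) {x : ℝ}
    (hx : contourRe τ η y ≤ x) : Real.exp (-τ * x) ≤ η * |y| := by
  have hpos : 0 < |y| * η := mul_pos (abs_pos.2 hy) hη
  calc Real.exp (-τ * x) ≤ Real.exp (-τ * contourRe τ η y) := by
        apply Real.exp_le_exp.2
        nlinarith
    _ = η * |y| := by
        have : -τ * contourRe τ η y = Real.log (|y| * η) := by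
          rw [contourRe]
          field_simp
        rw [this, Real.exp_log hpos, mul_comm]

theorem lt_contourRe_of_lt_exp (hτ : 0 < τ) (hη : 0 < η) (hy : 0 < y) {a : ℝ}
    (h : η * y < Real.exp (-a * τ)) : a < contourRe τ η y := by
  have h1 : Real.log (y * η) < -a * τ := (Real.log_lt_iff_lt_exp (by positivity)).2 (by linarith)
  rw [contourRe, abs_of_pos hy]
  have h2 : a = -(1 / τ) * (-a * τ) := by field_simp
  rw [h2]
  have : 0 < 1 / τ := by positivity
  nlinarith

theorem contourRe_nonpos (hτ : 0 < τ) (hy : 1 ≤ η * |y|) : contourRe τ η y ≤ 0 := by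
  have h1 : 0 ≤ Real.log (|y| * η) := Real.log_nonneg (by linarith)
  have : 0 < 1 / τ := by positivity
  rw [contourRe]
  nlinarith

/-- The crude `log u ≤ u` suffices: it bounds the length of horizontal segments on which the
integrand is `O(|y|⁻²)`. -/
theorem neg_contourRe_le (hτ : 0 < τ) (hη : 0 < η) : -contourRe τ η y ≤ η / τ * |y| := by
  have h1 : Real.log (|y| * η) ≤ |y| * η := Real.log_le_self (by positivity)
  have h2 : 0 < 1 / τ := by positivity
  have h3 : -contourRe τ η y = 1 / τ * Real.log (|y| * η) := by rw [contourRe]; ring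
  have h4 : η / τ * |y| = 1 / τ * (|y| * η) := by ring
  rw [h3, h4]
  gcongr

/-- Since `x'(y) = -1/(τy)`, the integrand is the derivative of `-e^{x(y)t}/(t/τ)`. Dropping the
endpoint `b` makes the bound uniform in `b`. -/
theorem integral_exp_contourRe_div_le (hτ : 0 < τ) (hη : 0 < η) {t a b : ℝ} (ht : 0 < t)
    (ha : 0 < a) (hab : a ≤ b) :
    IntervalIntegrable (fun y => Real.exp (contourRe τ η y * t) * |y|⁻¹) volume a b ∧
    ∫ y in a..b, Real.exp (contourRe τ η y * t) * |y|⁻¹ ≤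
      Real.exp (contourRe τ η a * t) / (t / τ) := by
  have hne : ∀ y ∈ Icc a b, y ≠ 0 := fun y hy => (ha.trans_le hy.1).ne'
  have hd : ∀ y ∈ Icc a b, HasDerivAt (fun y => -(Real.exp (contourRe τ η y * t) / (t / τ)))
      (Real.exp (contourRe τ η y * t) * |y|⁻¹) y := by
    intro y hy
    refine (((hasDerivAt_contourRe (τ := τ) hη (hne y hy)).mul_const t).exp.div_const
      (t / τ)).neg.congr_deriv ?_
    rw [abs_of_pos (ha.trans_le hy.1)]
    field_simp
  have hi : IntervalIntegrable (fun y => Real.exp (contourRe τ η y * t) * |y|⁻¹) volume a b := by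
    refine ContinuousOn.intervalIntegrable_of_Icc hab fun y hy => ?_
    have h1 := (hasDerivAt_contourRe (τ := τ) hη (hne y hy)).continuousAt
    exact ((h1.mul_const t).rexp.mul
      (continuous_abs.continuousAt.inv₀ (abs_ne_zero.2 (hne y hy)))).continuousWithinAt
  refine ⟨hi, ?_⟩
  rw [intervalIntegral.integral_eq_sub_of_hasDerivAt (fun y hy => hd y (uIcc_of_le hab ▸ hy)) hi]
  have : 0 ≤ Real.exp (contourRe τ η b * t) / (t / τ) := by positivity
  linarith

end ContourFunction

/-! ### Moving the line of integration to the contour -/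

section Deformation

variable {n : ℕ} {A B : Matrix (Fin n) (Fin n) ℂ} {τ η : ℝ}

theorem norm_exp_smul_resolventDiff_le (hA : A.IsHermitian) (hB : ‖B‖ * η < 1) {z : ℂ}
    (hz : z.im ≠ 0) (he : Real.exp (-τ * z.re) ≤ η * |z.im|) (t : ℝ) :
    ‖exp (z * t) • resolventDiff A B τ z‖ ≤
      Real.exp (z.re * t) * (Real.exp (-τ * z.re) * ‖B‖ * |z.im|⁻¹ *
        (|z.im|⁻¹ * (1 - ‖B‖ * η)⁻¹)) := by
  have : (z * t).re = z.re * t := by simp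
  rw [norm_smul, norm_exp, this]
  gcongr
  exact norm_inv_charMatrix_sub_resolventMatrix_le hA hz he hB

/-- The bound on the horizontal segments that close the contour. -/
theorem norm_integral_horizontal_le (hA : A.IsHermitian) (hτ : 0 < τ) (hη : 0 < η)
    (hB : ‖B‖ * η < 1) {t c y : ℝ} (ht : τ ≤ t) (hc : 0 ≤ c) (hy : 1 ≤ η * |y|) :
    ‖∫ x in (contourRe τ η y)..c,
        exp ((x + y * I) * t) • resolventDiff A B τ (x + y * I)‖ ≤
      Real.exp ((t - τ) * c) * ‖B‖ * (1 - ‖B‖ * η)⁻¹ *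
        (c * |y|⁻¹ ^ 2 + η / τ * |y|⁻¹) := by
  have hy0 : 0 < |y| := by
    by_contra! h
    nlinarith
  have hq : 0 < 1 - ‖B‖ * η := by linarith
  have hle : contourRe τ η y ≤ c := (contourRe_nonpos hτ hy).trans hc
  refine (intervalIntegral.norm_integral_le_of_norm_le_const
    (C := Real.exp ((t - τ) * c) * ‖B‖ * (1 - ‖B‖ * η)⁻¹ * |y|⁻¹ ^ 2) ?_).trans ?_
  · intro x hx
    rw [uIoc_of_le hle] at hx
    have h := norm_exp_smul_resolventDiff_le (z := x + y * I) (τ := τ) hA hB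
      (by simpa using abs_pos.1 hy0)
      (by simpa using exp_neg_mul_le_of_contourRe_le hτ hη (abs_pos.1 hy0) hx.1.le) t
    simp only [add_re, ofReal_re, mul_re, I_re, mul_zero, ofReal_im, I_im, mul_one, sub_self,
      add_zero, add_im, mul_im, zero_add] at h
    refine h.trans ?_
    have h1 : Real.exp (x * t) * (Real.exp (-τ * x) * ‖B‖ * |y|⁻¹ *
        (|y|⁻¹ * (1 - ‖B‖ * η)⁻¹)) =
        Real.exp ((t - τ) * x) * ‖B‖ * (1 - ‖B‖ * η)⁻¹ * |y|⁻¹ ^ 2 := by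
      have : (t - τ) * x = x * t + -τ * x := by ring
      rw [this, Real.exp_add]
      ring
    rw [h1]
    -- Here `t ≥ τ` enters: `e^{xt} e^{-τx}` must be nondecreasing in `x` to be bounded by its value
    -- at `c`, uniformly in `y`.
    have h2 : (t - τ) * x ≤ (t - τ) * c := mul_le_mul_of_nonneg_left hx.2 (by linarith)
    gcongr
  · have h1 : |c - contourRe τ η y| ≤ c + η / τ * |y| := by
      rw [abs_of_nonneg (by linarith)]
      linarith [neg_contourRe_le (y := y) hτ hη]
    calc _ ≤ Real.exp ((t - τ) * c) * ‖B‖ * (1 - ‖B‖ * η)⁻¹ * |y|⁻¹ ^ 2 *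
          (c + η / τ * |y|) := by gcongr
      _ = _ := by field_simp

theorem norm_tail_integrand_le (hA : A.IsHermitian) (hτ : 0 < τ) (hη : 0 < η)
    (hB : ‖B‖ * η < 1) (t : ℝ) {y₀ y : ℝ} (hy₀ : 0 < y₀) (hy : y₀ ≤ |y|) :
    ‖(((-(1 / τ) * y⁻¹ : ℝ) : ℂ) + I) • (exp ((contourRe τ η y + y * I) * t) •
        resolventDiff A B τ (contourRe τ η y + y * I))‖ ≤
      Real.pi * tailConstant B τ η y₀ * (Real.exp (contourRe τ η y * t) * |y|⁻¹) := by
  have hy1 : 0 < |y| := hy₀.trans_le hy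
  have hy0 : y ≠ 0 := abs_pos.1 hy1
  have hq : 0 < 1 - ‖B‖ * η := by linarith
  -- The arc length factor `|x'(y) + i|` decreases in `|y|`, so it is largest at `y₀`.
  have hn : ‖((-(1 / τ) * y⁻¹ : ℝ) : ℂ) + I‖ ≤ Real.sqrt (((τ * y₀) ^ 2)⁻¹ + 1) := by
    have := norm_add_mul_I (-(1 / τ) * y⁻¹) 1
    rw [ofReal_one, one_mul] at this
    rw [this]
    apply Real.sqrt_le_sqrt
    have h1 : (-(1 / τ) * y⁻¹) ^ 2 = ((τ * |y|) ^ 2)⁻¹ := by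
      rw [mul_pow τ, sq_abs]
      field_simp
    rw [h1, one_pow]
    gcongr
  have h := norm_exp_smul_resolventDiff_le (z := contourRe τ η y + y * I) (τ := τ) hA hB
    (by simpa using hy0)
    (by simpa using exp_neg_mul_le_of_contourRe_le hτ hη hy0 le_rfl) t
  simp only [add_re, ofReal_re, mul_re, I_re, mul_zero, ofReal_im, I_im, mul_one, sub_self,
    add_zero, add_im, mul_im, zero_add] at h
  have he := exp_neg_mul_le_of_contourRe_le hτ hη hy0 (le_refl (contourRe τ η y))
  rw [norm_smul]
  calc _ ≤ Real.sqrt (((τ * y₀) ^ 2)⁻¹ + 1) * (Real.exp (contourRe τ η y * t) *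
        ((η * |y|) * ‖B‖ * |y|⁻¹ * (|y|⁻¹ * (1 - ‖B‖ * η)⁻¹))) := by
        refine mul_le_mul hn (h.trans ?_) (norm_nonneg _) (Real.sqrt_nonneg _)
        gcongr
    _ = _ := by
        rw [tailConstant]
        field_simp

/-- The bound on the two curved parts of the contour. -/
theorem norm_integral_tail_le (hA : A.IsHermitian) (hτ : 0 < τ) (hη : 0 < η)
    (hB : ‖B‖ * η < 1) {t y₀ Y : ℝ} (ht : 0 < t) (hy₀ : 0 < y₀) (hY : y₀ ≤ Y) :
    ‖∫ y in y₀..Y, (((-(1 / τ) * y⁻¹ : ℝ) : ℂ) + I) • (exp ((contourRe τ η y + y * I) * t) •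
        resolventDiff A B τ (contourRe τ η y + y * I))‖ ≤
      Real.pi * tailConstant B τ η y₀ * (Real.exp (contourRe τ η y₀ * t) / (t / τ)) ∧
    ‖∫ y in (-Y)..(-y₀), (((-(1 / τ) * y⁻¹ : ℝ) : ℂ) + I) •
        (exp ((contourRe τ η y + y * I) * t) •
        resolventDiff A B τ (contourRe τ η y + y * I))‖ ≤
      Real.pi * tailConstant B τ η y₀ * (Real.exp (contourRe τ η y₀ * t) / (t / τ)) := by
  have hq : 0 < 1 - ‖B‖ * η := by linarith
  have hC : 0 ≤ Real.pi * tailConstant B τ η y₀ := by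
    rw [tailConstant]
    positivity
  obtain ⟨hi, hle⟩ := integral_exp_contourRe_div_le hτ hη ht hy₀ hY
  have hle' := mul_le_mul_of_nonneg_left hle hC
  rw [← intervalIntegral.integral_const_mul] at hle'
  constructor
  · refine le_trans (intervalIntegral.norm_integral_le_of_norm_le hY
      (Eventually.of_forall fun y hy => ?_) (hi.const_mul _)) hle'
    exact norm_tail_integrand_le hA hτ hη hB t hy₀ (hy.1.le.trans (le_abs_self y))
  · rw [← intervalIntegral.integral_comp_neg]
    refine le_trans (intervalIntegral.norm_integral_le_of_norm_le hY
      (Eventually.of_forall fun y hy => ?_) (hi.const_mul _)) hle'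
    have := norm_tail_integrand_le (y := -y) hA hτ hη hB t hy₀
      ((hy.1.le.trans (le_abs_self y)).trans_eq (abs_neg y).symm)
    rw [abs_neg] at this
    simpa only [contourRe_neg] using this

theorem continuous_resolventDiff_vertical (hτ : 0 < τ) {c : ℝ}
    (hcA : spectralAbscissa A < c) (hcT : functionAbscissa (charMatrix A B τ) < c) :
    Continuous fun y : ℝ => resolventDiff A B τ (c + y * I) := by
  refine continuous_iff_continuousAt.2 fun y => ?_
  have := (differentiableAt_inv_charMatrix_sub_resolventMatrix (z := c + y * I)
    (isUnit_charMatrix_of_functionAbscissa_lt hτ (B := B) (A := A) (by simpa using hcT))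
    (isUnit_smul_one_sub_of_spectralAbscissa_lt (by simpa using hcA))).continuousAt
  exact ContinuousAt.comp (f := fun y : ℝ => (c : ℂ) + y * I) this (by fun_prop)

theorem integrable_resolventDiff_vertical (hA : A.IsHermitian) (hτ : 0 < τ) (hη : 0 < η)
    (hB : ‖B‖ * η < 1) {c : ℝ} (hc : 0 ≤ c)
    (hcA : spectralAbscissa A < c) (hcT : functionAbscissa (charMatrix A B τ) < c) :
    Integrable fun y : ℝ => resolventDiff A B τ (c + y * I) := by
  refine (continuous_resolventDiff_vertical hτ hcA hcT).locallyIntegrable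
    |>.integrable_of_isBigO_cocompact (g := fun y : ℝ => (1 + y ^ 2)⁻¹) ?_
    (integrable_inv_one_add_sq.integrableAtFilter _)
  have hq : 0 < 1 - ‖B‖ * η := by linarith
  refine Asymptotics.IsBigO.of_bound (2 * (‖B‖ * (1 - ‖B‖ * η)⁻¹)) ?_
  -- Beyond `η⁻¹` one has `|e^{-τz}| ≤ 1 ≤ η |y|`, so the resolvent estimate applies; beyond `1` one
  -- has `|y|⁻² ≤ 2/(1 + y²)`.
  have hmem : (Icc (-(1 + η⁻¹)) (1 + η⁻¹))ᶜ ∈ cocompact ℝ := isCompact_Icc.compl_mem_cocompact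
  filter_upwards [hmem] with y hy
  have hy1 : 1 + η⁻¹ < |y| := by
    by_contra! h
    exact hy (abs_le.1 h)
  have hη' : 0 < η⁻¹ := by positivity
  have hy0 : 0 < |y| := by linarith
  have he : Real.exp (-τ * c) ≤ 1 := by
    rw [Real.exp_le_one_iff]
    nlinarith
  have h1 : 1 ≤ η * |y| := by
    rw [mul_comm, ← div_le_iff₀ hη, one_div]
    linarith
  have h := norm_inv_charMatrix_sub_resolventMatrix_le (B := B) (τ := τ) (z := c + y * I) hA
    (by simpa using abs_pos.1 hy0) (by simpa using he.trans h1) hB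
  simp only [add_re, ofReal_re, mul_re, I_re, mul_zero, ofReal_im, I_im, mul_one, sub_self,
    add_zero, add_im, mul_im, zero_add] at h
  have h2 : |y|⁻¹ * |y|⁻¹ ≤ 2 * (1 + y ^ 2)⁻¹ := by
    rw [← mul_inv, ← sq, sq_abs, ← div_eq_mul_inv, le_div_iff₀ (by positivity),
      inv_mul_le_iff₀ (by rw [← sq_abs]; positivity), ← sq_abs]
    nlinarith
  rw [Real.norm_of_nonneg (by positivity)]
  calc _ ≤ _ := h
    _ ≤ 1 * ‖B‖ * |y|⁻¹ * (|y|⁻¹ * (1 - ‖B‖ * η)⁻¹) := by gcongr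
    _ = ‖B‖ * (1 - ‖B‖ * η)⁻¹ * (|y|⁻¹ * |y|⁻¹) := by ring
    _ ≤ ‖B‖ * (1 - ‖B‖ * η)⁻¹ * (2 * (1 + y ^ 2)⁻¹) := by gcongr
    _ = _ := by ring

/-- The integral over a vertical line in the right half plane is moved to the contour. -/
theorem integral_vertical_eq_integral_contour (hA : A.IsHermitian) (hτ : 0 < τ) (hη : 0 < η)
    (hB : ‖B‖ * η < 1) {t c y₀ Y : ℝ} (hc : 0 ≤ c) (hy₀ : 0 < y₀) (hηy : 1 ≤ η * y₀)
    (hY : y₀ ≤ Y) (hxA : spectralAbscissa A < contourRe τ η y₀)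
    (hxT : functionAbscissa (charMatrix A B τ) < contourRe τ η y₀)
    {G : ℂ → Matrix (Fin n) (Fin n) ℂ} (hG : ∀ z, G z = exp (z * t) • resolventDiff A B τ z) :
    ∫ y in (-Y)..Y, I • G (c + y * I) =
      (∫ y in (-y₀)..y₀, I • G (contourRe τ η y₀ + y * I)) +
      ((∫ y in y₀..Y, (((-(1 / τ) * y⁻¹ : ℝ) : ℂ) + I) • G (contourRe τ η y + y * I)) +
        (∫ y in (-Y)..(-y₀), (((-(1 / τ) * y⁻¹ : ℝ) : ℂ) + I) • G (contourRe τ η y + y * I))) +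
      ((∫ x in (contourRe τ η Y)..c, G (x + Y * I)) -
        ∫ x in (contourRe τ η (-Y))..c, G (x + (-Y : ℝ) * I)) := by
  have hGd : ∀ z, IsUnit (charMatrix A B τ z) → IsUnit (z • (1 : Matrix (Fin n) (Fin n) ℂ) - A) →
      DifferentiableAt ℂ G z := by
    intro z h1 h2
    rw [show G = fun z => exp (z * t) • resolventDiff A B τ z from funext hG]
    exact (by fun_prop : DifferentiableAt ℂ (fun z : ℂ => exp (z * t)) z).smul
      (differentiableAt_inv_charMatrix_sub_resolventMatrix h1 h2)
  have htail : ∀ a b : ℝ, a ≤ b → (∀ y ∈ Icc a b, y₀ ≤ |y|) → (Icc a b ⊆ Ioi 0 ∨ Icc a b ⊆ Iio 0) →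
      ∫ y in a..b, I • G (c + y * I) =
        (∫ y in a..b, (((-(1 / τ) * y⁻¹ : ℝ) : ℂ) + I) • G (contourRe τ η y + y * I))
        + (∫ x in (contourRe τ η b)..c, G (x + b * I))
        - ∫ x in (contourRe τ η a)..c, G (x + a * I) := by
    intro a b hab hy hs
    have hne : ∀ y ∈ Icc a b, y ≠ 0 := fun y h => abs_pos.1 (hy₀.trans_le (hy y h))
    refine integral_vertical_eq_integral_graph hab
      (convexOn_contourRe hτ hη (convex_Icc a b) hs)
      (fun y h => hasDerivAt_contourRe hη (hne y h))
      (continuousOn_const.mul (continuousOn_id.inv₀ hne))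
      (fun y h => (contourRe_nonpos hτ (hηy.trans (by gcongr; exact hy y h))).trans hc)
      fun z h1 h2 => hGd z ?_ ?_
    · exact isUnit_charMatrix_of_exp_le hA (hne _ h1)
        (exp_neg_mul_le_of_contourRe_le hτ hη (hne _ h1) h2) hB
    · exact isUnit_smul_one_sub_of_im_ne_zero hA (hne _ h1)
  have hx0 : contourRe τ η y₀ ≤ 0 := contourRe_nonpos hτ (by rwa [abs_of_pos hy₀])
  have hmid := integral_vertical_eq_integral_graph (F := G) (a := -y₀) (b := y₀) (c := c)
    (g := fun _ => contourRe τ η y₀) (g' := fun _ => 0) (by linarith)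
    (convexOn_const _ (convex_Icc _ _)) (fun y _ => hasDerivAt_const _ _) continuousOn_const
    (fun y _ => hx0.trans hc)
    (fun z _ h2 => hGd z (isUnit_charMatrix_of_functionAbscissa_lt hτ (hxT.trans_le h2))
      (isUnit_smul_one_sub_of_spectralAbscissa_lt (hxA.trans_le h2)))
  have hup := htail y₀ Y hY (fun y h => h.1.trans (le_abs_self y))
    (Or.inl fun y h => hy₀.trans_le h.1)
  have hlow := htail (-Y) (-y₀) (by linarith)
    (fun y h => (by linarith [h.2] : y₀ ≤ -y).trans (neg_le_abs y))
    (Or.inr fun y h => mem_Iio.2 (by linarith [h.2]))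
  have hcont : Continuous fun y : ℝ => I • G (c + y * I) := by
    simp only [hG]
    exact ((by fun_prop : Continuous fun y : ℝ => exp ((c + y * I) * t)).smul
      (continuous_resolventDiff_vertical hτ (hxA.trans_le (hx0.trans hc))
        (hxT.trans_le (hx0.trans hc)))).const_smul I
  -- The horizontal integrals at heights `±y₀` cancel between neighbouring regions because `x` is
  -- even; only those at `±Y` survive.
  rw [← intervalIntegral.integral_add_adjacent_intervals
      (hcont.intervalIntegrable (-Y) y₀) (hcont.intervalIntegrable y₀ Y),
    ← intervalIntegral.integral_add_adjacent_intervals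
      (hcont.intervalIntegrable (-Y) (-y₀)) (hcont.intervalIntegrable (-y₀) y₀), hup, hlow, hmid,
    contourRe_neg τ η y₀]
  simp only [ofReal_zero, zero_add]
  abel

end Deformation

/-! ### Inversion formula and the limit of the truncated contours -/

section Inversion

variable {n : ℕ} {A B : Matrix (Fin n) (Fin n) ℂ} {τ η : ℝ} {Ψ : ℝ → Matrix (Fin n) (Fin n) ℂ}

/-- The inversion formula for the difference between the fundamental solution and `e^{tA}`. -/
theorem IsFundamentalSolution.sub_exp_eq_integral (hΨ : IsFundamentalSolution A B τ Ψ)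
    (hτ : 0 < τ) {c : ℝ} (hc : ‖A‖ + ‖B‖ + 1 < c)
    (hi : Integrable fun y : ℝ => resolventDiff A B τ (c + y * I)) {t : ℝ} (ht : 0 ≤ t) :
    (2 * Real.pi : ℝ) • (Ψ t - NormedSpace.exp (t • A)) =
      ∫ y : ℝ, exp ((c + y * I) * t) • resolventDiff A B τ (c + y * I) := by
  have hE := isFundamentalSolution_exp A τ
  set Φ := stepTermPos A (0 : Matrix (Fin n) (Fin n) ℂ) 0 with hΦ
  have hΦt : ∀ s, 0 ≤ s → Φ s = NormedSpace.exp (s • A) := fun s hs => by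
    simp [hΦ, stepTermPos, stepTerm, not_lt.2 hs]
  -- Both solutions equal `I` at `0`, so `D` is continuous and vanishes for negative times, as
  -- inversion requires. The `max` also discards times before `-τ`, where `Ψ` is unconstrained.
  let D : ℝ → Matrix (Fin n) (Fin n) ℂ := fun s => Ψ (max s 0) - Φ (max s 0)
  have hDs : ∀ s, 0 ≤ s → D s = Ψ s - Φ s := fun s hs => by simp [D, max_eq_left hs]
  have hm : ∀ s : ℝ, max s 0 ∈ Ici (0 : ℝ) := fun s => le_max_right s 0
  have hDc : Continuous D :=
    (hΨ.continuousOn.comp_continuous (by fun_prop) hm).sub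
      (hE.continuousOn.comp_continuous (by fun_prop) hm)
  have hA0 : ‖A‖ + ‖(0 : Matrix (Fin n) (Fin n) ℂ)‖ + 1 ≤ ‖A‖ + ‖B‖ + 1 := by simp
  have hbd : ∀ s, 0 ≤ s → ‖D s‖ ≤
      (2 * (‖(1 : Matrix (Fin n) (Fin n) ℂ)‖ + 1)) * Real.exp ((‖A‖ + ‖B‖ + 1) * s) := by
    intro s hs
    have h2 : ‖Φ s‖ ≤
        (‖(1 : Matrix (Fin n) (Fin n) ℂ)‖ + 1) * Real.exp ((‖A‖ + ‖B‖ + 1) * s) :=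
      (hE.norm_le hτ s hs).trans (by gcongr)
    rw [hDs s hs]
    linarith [norm_sub_le (Ψ s) (Φ s), hΨ.norm_le hτ s hs]
  have hF : ∀ y : ℝ, resolventDiff A B τ (c + y * I) =
      ∫ s in Ioi (0 : ℝ), exp (-(c + y * I) * s) • D s := by
    intro y
    have hz : ‖A‖ + ‖B‖ + 1 < (c + y * I : ℂ).re := by simpa using hc
    have hR : resolventMatrix A (c + y * I) = (charMatrix A 0 τ (c + y * I))⁻¹ := by
      simp [resolventMatrix, charMatrix]
    rw [resolventDiff, hR, ← hΨ.laplace_eq hτ hz, ← hE.laplace_eq hτ (hA0.trans_lt hz),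
      ← integral_sub (integrableOn_exp_neg_smul hΨ.continuousOn (hΨ.norm_le hτ) hz)
        (integrableOn_exp_neg_smul hE.continuousOn (hE.norm_le hτ) (hA0.trans_lt hz))]
    refine setIntegral_congr_fun measurableSet_Ioi fun s hs => ?_
    simp only [hDs s (le_of_lt hs), smul_sub]
  have h := laplace_inversion hDc
    (fun s hs => by simp [D, max_eq_right hs.le, hΨ.eq_one, hE.eq_one]) hbd hc hF hi t
  rwa [hDs t ht, hΦt t ht] at h

/-- The norm of the inversion integral is at most the sum of the bounds on the pieces of the
contour. -/
theorem norm_integral_vertical_le (hA : A.IsHermitian) (hτ : 0 < τ) (hη : 0 < η)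
    (hB : ‖B‖ * η < 1) {t c y₀ : ℝ} (ht : τ ≤ t) (hc : 0 ≤ c) (hy₀ : 0 < y₀)
    (hηy : 1 ≤ η * y₀) (hxA : spectralAbscissa A < contourRe τ η y₀)
    (hxT : functionAbscissa (charMatrix A B τ) < contourRe τ η y₀) :
    ‖∫ y : ℝ, exp ((c + y * I) * t) • resolventDiff A B τ (c + y * I)‖ ≤
      Real.exp (contourRe τ η y₀ * t) *
        (∫ y in (-y₀)..y₀, ‖resolventDiff A B τ (contourRe τ η y₀ + y * I)‖) +
      2 * (Real.pi * tailConstant B τ η y₀ * (Real.exp (contourRe τ η y₀ * t) / (t / τ))) := by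
  have hx0 : contourRe τ η y₀ ≤ 0 := contourRe_nonpos hτ (by rwa [abs_of_pos hy₀])
  have hcA := hxA.trans_le (hx0.trans hc)
  have hcT := hxT.trans_le (hx0.trans hc)
  have hint : Integrable fun y : ℝ => exp ((c + y * I) * t) • resolventDiff A B τ (c + y * I) := by
    refine (integrable_resolventDiff_vertical hA hτ hη hB hc hcA hcT).bdd_smul
      (Real.exp (c * t))
      (by fun_prop : Continuous fun y : ℝ => exp ((c + y * I) * t)).aestronglyMeasurable
      (Eventually.of_forall fun y => ?_)
    rw [norm_exp]
    simp
  have hlim := (intervalIntegral_tendsto_integral hint tendsto_neg_atTop_atBot tendsto_id).norm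
  set M₀ := Real.exp (contourRe τ η y₀ * t) *
    (∫ y in (-y₀)..y₀, ‖resolventDiff A B τ (contourRe τ η y₀ + y * I)‖)
  set M₁ := Real.pi * tailConstant B τ η y₀ * (Real.exp (contourRe τ η y₀ * t) / (t / τ))
  set Q := Real.exp ((t - τ) * c) * ‖B‖ * (1 - ‖B‖ * η)⁻¹
  have hinv : Tendsto (fun Y : ℝ => Y⁻¹) atTop (𝓝 0) := tendsto_inv_atTop_zero
  -- The segment and curve bounds do not depend on `Y`; the two horizontal pieces are `O(1/Y)` and
  -- vanish in the limit.
  have hrhs : Tendsto (fun Y : ℝ => M₀ + 2 * M₁ + 2 * (Q * (c * Y⁻¹ ^ 2 + η / τ * Y⁻¹)))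
      atTop (𝓝 (M₀ + 2 * M₁)) := by
    have := (((((hinv.pow 2).const_mul c).add (hinv.const_mul (η / τ))).const_mul Q).const_mul
      2).const_add (M₀ + 2 * M₁)
    simpa using this
  refine le_of_tendsto_of_tendsto hlim hrhs ?_
  filter_upwards [eventually_ge_atTop y₀] with Y hY
  have hYpos : 0 < Y := hy₀.trans_le hY
  have hηY : 1 ≤ η * |Y| := by
    rw [abs_of_pos hYpos]
    exact hηy.trans (by gcongr)
  have hcont : Continuous fun y : ℝ =>
      resolventDiff A B τ (contourRe τ η y₀ + y * I) := continuous_resolventDiff_vertical hτ hxA hxT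
  have h0 : ‖∫ y in (-y₀)..y₀, I • exp ((contourRe τ η y₀ + y * I) * t) •
      resolventDiff A B τ (contourRe τ η y₀ + y * I)‖ ≤ M₀ := by
    refine (intervalIntegral.norm_integral_le_of_norm_le (by linarith)
      (Eventually.of_forall fun y _ => ?_) ((hcont.norm.const_mul
        (Real.exp (contourRe τ η y₀ * t))).intervalIntegrable _ _)).trans_eq
      (intervalIntegral.integral_const_mul _ _)
    rw [norm_smul, norm_smul, norm_I, one_mul, norm_exp]
    simp
  obtain ⟨h1, h2⟩ := norm_integral_tail_le (B := B) hA hτ hη hB (hτ.trans_le ht) hy₀ hY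
  have h3 := norm_integral_horizontal_le (B := B) hA hτ hη hB ht hc hηY
  have h4 := norm_integral_horizontal_le (B := B) (y := -Y) hA hτ hη hB ht hc (by rwa [abs_neg])
  rw [abs_neg] at h4
  rw [abs_of_pos hYpos] at h3 h4
  have heq := integral_vertical_eq_integral_contour (t := t) hA hτ hη hB hc hy₀ hηy hY hxA hxT
    (fun _ => rfl)
  rw [intervalIntegral.integral_smul] at heq
  have hnorm := congrArg norm heq
  rw [norm_smul, norm_I, one_mul] at hnorm
  change ‖∫ y in (-Y)..Y, exp ((c + y * I) * t) • resolventDiff A B τ (c + y * I)‖ ≤ _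
  rw [hnorm]
  refine (norm_add₃_le).trans ?_
  have h5 := (norm_add_le _ _).trans (add_le_add h1 h2)
  have h6 := (norm_sub_le _ _).trans (add_le_add h3 h4)
  refine (add_le_add (add_le_add h0 h5) h6).trans_eq ?_
  ring

end Inversion

end DelayDE

end

theorem mainTheorem1 {n : ℕ} (A B : Matrix (Fin n) (Fin n) ℂ) (hA : A.IsHermitian)
    (τ : ℝ) (hτ : 0 < τ)
    (hαA : DelayDE.spectralAbscissa A < 0)
    (hαT : DelayDE.functionAbscissa (DelayDE.charMatrix A B τ) < 0)
    (y₀ η : ℝ) (hy₀ : 0 < y₀)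
    (hη : 1 < η * y₀)
    (hηB : η * y₀ * ‖B‖ < y₀)
    (hηT : η * y₀ < Real.exp (-DelayDE.functionAbscissa (DelayDE.charMatrix A B τ) * τ))
    (hηA : η * y₀ < Real.exp (-DelayDE.spectralAbscissa A * τ))
    (Ψ : ℝ → Matrix (Fin n) (Fin n) ℂ) (hΨ : DelayDE.IsFundamentalSolution A B τ Ψ)
    (t : ℝ) (ht : τ ≤ t) :
    ‖Ψ t‖ ≤ ‖NormedSpace.exp ((t : ℂ) • A)‖
      + Real.exp (DelayDE.contourRe τ η y₀ * t) * DelayDE.contourIntegral A B τ η y₀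
      + Real.exp (DelayDE.contourRe τ η y₀ * t) *
          (DelayDE.tailConstant B τ η y₀ / (t / τ)) := by
  have hη0 : 0 < η := pos_of_mul_pos_left (by linarith) hy₀.le
  have hB : ‖B‖ * η < 1 := by
    by_contra! h
    nlinarith
  have hxA := DelayDE.lt_contourRe_of_lt_exp hτ hη0 hy₀ hηA
  have hxT := DelayDE.lt_contourRe_of_lt_exp hτ hη0 hy₀ hηT
  -- The line `Re z = ‖A‖ + ‖B‖ + 2` is an arbitrary choice beyond the growth exponent of `Ψ`; the
  -- final bound does not involve it.
  have hc : ‖A‖ + ‖B‖ + 1 < ‖A‖ + ‖B‖ + 2 := by linarith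
  have hc0 : 0 ≤ ‖A‖ + ‖B‖ + 2 := by positivity
  have hinv := hΨ.sub_exp_eq_integral hτ hc
    (DelayDE.integrable_resolventDiff_vertical hA hτ hη0 hB hc0 (hαA.trans_le hc0)
      (hαT.trans_le hc0)) (hτ.le.trans ht)
  have hle := DelayDE.norm_integral_vertical_le hA hτ hη0 hB ht hc0 hy₀ hη.le hxA hxT
  have hpi : (0 : ℝ) < 2 * Real.pi := by positivity
  rw [← hinv, norm_smul, Real.norm_of_nonneg hpi.le, ← le_div_iff₀' hpi] at hle
  have htri : ‖Ψ t‖ ≤ ‖NormedSpace.exp (t • A)‖ + ‖Ψ t - NormedSpace.exp (t • A)‖ := by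
    simpa using norm_add_le (NormedSpace.exp (t • A)) (Ψ t - NormedSpace.exp (t • A))
  rw [Complex.coe_smul, add_assoc]
  refine htri.trans (add_le_add_right (hle.trans_eq ?_) _)
  simp only [DelayDE.contourIntegral, ← DelayDE.resolventDiff.eq_1]
  generalize (∫ y in (-y₀)..y₀, ‖DelayDE.resolventDiff A B τ
    (DelayDE.contourRe τ η y₀ + y * Complex.I)‖) = J
  have ht0 : t ≠ 0 := (hτ.trans_le ht).ne'
  field_simp
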